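/- For $\delta>0$ call a point $x\in\mathbb{R}^d$ $\delta$-extremal if there is $Q_0>0$ such that for every real $Q>Q_0$ there exist $p\in\mathbb{Z}^d$ and an integer $q$ with $0<q\le Q$ and $\|qx-p\|_\infty\le Q^{-\delta}$. A rational hyperplane of $\mathbb{R}^d$ is a set $\{x\in\mathbb{R}^d : a_1x_1+\dots+a_dx_d=b\}$ with $a\in\mathbb{Q}^d\setminus\{0\}$ and $b\in\mathbb{Q}$. Theorem. There exists $\delta$ with $0<\delta<1$ which satisfies the following. For all integers $1\le k<d$ there exist uncountably many connected (embedded) real-analytic submanifolds $\mathcal{M}\subset\mathbb{R}^d$ of dimension $k$ that are not contained in any rational hyperplane and such that every $\delta$-extremal point of $\mathcal{M}$ lies on a rational hyperplane. -/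

import Mathlib

/-- `x ∈ ℝ^d` is `δ`-extremal if for every sufficiently large `Q` the system
`‖q x - p‖ ≤ Q^{-δ}`, `0 < q ≤ Q` has a solution `(p, q) ∈ ℤ^d × ℕ`.
The norm on `Fin d → ℝ` is the sup norm. -/
def IsDeltaExtremal {d : ℕ} (δ : ℝ) (x : Fin d → ℝ) : Prop :=
  ∃ Q₀ : ℝ, 0 < Q₀ ∧ ∀ Q : ℝ, Q₀ < Q →
    ∃ (q : ℕ) (p : Fin d → ℤ), 0 < q ∧ (q : ℝ) ≤ Q ∧
      ‖fun i => (q : ℝ) * x i - (p i : ℝ)‖ ≤ Q ^ (-δ)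

/-- A rational (affine) hyperplane of `ℝ^d`: the zero set of a nonconstant affine function with
rational coefficients. -/
def IsRationalHyperplane {d : ℕ} (H : Set (Fin d → ℝ)) : Prop :=
  ∃ (a : Fin d → ℚ) (b : ℚ), a ≠ 0 ∧ H = {x | ∑ i, (a i : ℝ) * x i = (b : ℝ)}

/-- `M` is an (embedded) real-analytic submanifold of `ℝ^d` of dimension `k`: around each of its
points there is a bi-analytic chart of `ℝ^d` that carries `M` to the coordinate `k`-plane on which
the last `d - k` coordinates vanish. -/
def IsAnalyticSubmanifold {d : ℕ} (k : ℕ) (M : Set (Fin d → ℝ)) : Prop :=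
  k ≤ d ∧ ∀ x ∈ M, ∃ Φ : OpenPartialHomeomorph (Fin d → ℝ) (Fin d → ℝ),
    x ∈ Φ.source ∧ AnalyticOnNhd ℝ Φ Φ.source ∧ AnalyticOnNhd ℝ Φ.symm Φ.target ∧
      ∀ y ∈ Φ.source, y ∈ M ↔ ∀ i : Fin d, k ≤ (i : ℕ) → Φ y i = 0

/-!
The exponent is `δ = 19/20`. For a real number `a`, the manifold is the graph
`M_a = {x | x_k = a x_0, x_j = x_0 ^ j for j > k}`, parametrised by its first `k` coordinates, where
`a` is irrational and `|n a - m| ≥ c |n| ^ (-5/4)` for all integers `m` and `n ≠ 0`. Almost every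
real number `a` has this property, and `a` is determined by `M_a`, so there are uncountably many
such manifolds. A rational linear relation between the coordinates on `M_a` would be a polynomial
identity in `x_0`, and irrationality of `a` excludes it.

Only the coordinates `x_0 = t` and `x_k = a t` of an extremal point are needed. Take a sequence of
scales with `Q_{n+1} = Q_n ^ (3/2)` and let `z_n = (q_n, p_n, r_n)` be an integer solution of the
approximation problem for `(t, a t)` at scale `Q_n`.

* The number `a p_n - r_n` is `O(Q_n ^ (-19/20))`, whereas `p_n = O(q_n)`. If `z_n` and `z_{n+1}`
  were proportional, the shorter of them would give an integer vector of size `O(Q_n)` at which the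
  form `a p - r` is as small as `O(Q_n ^ (-57/40))`. This contradicts the Diophantine property of
  `a` (`cross_ne_zero_of_scales`).
* The determinant of `z_n, z_{n+1}, z_{n+2}` is an integer of size at most
  `6 Q_{n+2} (Q_n Q_{n+1}) ^ (-19/20) = 6 Q_n ^ (-1/8)`, hence zero (`det_eq_zero_of_scales`).

So all `z_n` lie in one rational plane, and so does their limiting direction `(1, t, a t)`
(`exists_int_relation`). The resulting relation between `1`, `x_0` and `x_k` is a rational
hyperplane through the point.
-/

open Filter Topology

/-! ### Diophantine numbers -/

/-- The irrational numbers `a` that satisfy `|n a - m| ≥ c |n| ^ (-5/4)` for some `c > 0` and all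
integers `m` and `n ≠ 0`. -/
def IsDiophantine (a : ℝ) : Prop :=
  Irrational a ∧ ∃ c : ℝ, 0 < c ∧ ∀ m n : ℤ, n ≠ 0 →
    c * |(n : ℝ)| ^ (-(5 / 4) : ℝ) ≤ |n * a - m|

theorem IsDiophantine.of_not_liouvilleWith {a : ℝ} (ha : Irrational a)
    (hL : ¬ LiouvilleWith (9 / 4) a) : IsDiophantine a := by
  have h1 : ∀ᶠ n : ℕ in atTop, ∀ m : ℤ, a ≠ m / n → 1 / (n : ℝ) ^ (9 / 4 : ℝ) ≤ |a - m / n| := by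
    by_contra hcon
    refine hL ⟨1, ?_⟩
    rw [Filter.not_eventually] at hcon
    refine hcon.mono fun n hn => ?_
    push Not at hn
    exact hn
  obtain ⟨N, hN⟩ := eventually_atTop.1 h1
  have hpos : ∀ n : ℕ, 0 < n → ∀ m : ℤ,
      ((N + 1 : ℕ) : ℝ) ^ (-(9 / 4) : ℝ) * (n : ℝ) ^ (-(5 / 4) : ℝ) ≤ |n * a - m| := by
    intro n hn m
    have hn' : (0 : ℝ) < n := by exact_mod_cast hn
    have hN' : (0 : ℝ) < ((N + 1 : ℕ) : ℝ) := by positivity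
    -- The estimate is available for large denominators only, so `m / n` is rewritten with
    -- denominator `(N + 1) n`.
    have hfrac : (((N + 1 : ℕ) : ℤ) * m : ℤ) / (((N + 1) * n : ℕ) : ℝ) = (m : ℝ) / n := by
      push_cast at hN' ⊢
      field_simp
    have hne : a ≠ (m : ℝ) / n := by
      have := ha.ne_rat (m / n)
      push_cast at this
      exact this
    have h2 := hN ((N + 1) * n) (by nlinarith) (((N + 1 : ℕ) : ℤ) * m) (by rw [hfrac]; exact hne)
    rw [hfrac] at h2
    have h3 : |n * a - m| = n * |a - m / n| := by
      rw [← abs_of_pos hn', ← abs_mul, abs_of_pos hn', mul_sub, mul_div_cancel₀ _ hn'.ne']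
    have h4 : (n : ℝ) ^ (-(5 / 4) : ℝ) = n * (n : ℝ) ^ (-(9 / 4) : ℝ) := by
      nth_rewrite 2 [← Real.rpow_one (n : ℝ)]
      rw [← Real.rpow_add hn']
      norm_num
    rw [h3, h4, mul_left_comm]
    refine mul_le_mul_of_nonneg_left ?_ hn'.le
    rwa [← Real.mul_rpow hN'.le hn'.le, Real.rpow_neg (by positivity), ← one_div, ← Nat.cast_mul]
  refine ⟨ha, ((N + 1 : ℕ) : ℝ) ^ (-(9 / 4) : ℝ), by positivity, fun m n hn => ?_⟩
  have habs : 0 < n.natAbs := Int.natAbs_pos.2 hn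
  have hcast : ((n.natAbs : ℕ) : ℝ) = |(n : ℝ)| := by
    rw [Nat.cast_natAbs, Int.cast_abs]
  rcases abs_choice (n : ℝ) with h | h
  · have := hpos n.natAbs habs m
    rw [hcast] at this
    rwa [h] at this ⊢
  · have := hpos n.natAbs habs (-m)
    rw [hcast] at this
    rw [h] at this ⊢
    rw [← abs_neg (n * a - m)]
    convert this using 2
    push_cast
    ring

theorem not_countable_isDiophantine : ¬ {a : ℝ | IsDiophantine a}.Countable := by
  intro hc
  have h1 : ∀ᵐ a : ℝ, ¬ IsDiophantine a := hc.ae_notMem MeasureTheory.volume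
  have h2 : ∀ᵐ a : ℝ, a ∉ Set.range ((↑) : ℚ → ℝ) :=
    (Set.countable_range _).ae_notMem MeasureTheory.volume
  obtain ⟨a, ha1, ha2, ha3⟩ := (h1.and (h2.and ae_not_liouvilleWith)).exists
  exact ha1 (.of_not_liouvilleWith ha2 (ha3 _ (by norm_num)))

/-! ### Approximation of the points `(t, a t)` of the plane -/

/-- Vectors of moderate size cannot make both `q t - p` and `a p - r` small. -/
theorem lower_bound_of_approx {a t c Q : ℝ} (hc : 0 < c)
    (hdio : ∀ m n : ℤ, n ≠ 0 → c * |(n : ℝ)| ^ (-(5 / 4) : ℝ) ≤ |n * a - m|)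
    {q p r : ℤ} (hq : 0 < q) (hqQ : (q : ℝ) ≤ Q) (hp0 : p ≠ 0) (hp : |q * t - p| ≤ 1) :
    c * ((|t| + 1) * Q) ^ (-(5 / 4) : ℝ) ≤ |p * a - r| := by
  refine le_trans (mul_le_mul_of_nonneg_left ?_ hc.le) (hdio r p hp0)
  have hq1 : (1 : ℝ) ≤ q := by exact_mod_cast hq
  have hp' : (0 : ℝ) < |(p : ℝ)| := abs_pos.2 (by exact_mod_cast hp0)
  refine Real.rpow_le_rpow_of_nonpos hp' ?_ (by norm_num)
  calc |(p : ℝ)| = |q * t - (q * t - p)| := by ring_nf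
    _ ≤ |q * t| + |q * t - p| := abs_sub _ _
    _ ≤ q * |t| + q := by rw [abs_mul, abs_of_pos (by linarith : (0 : ℝ) < q)]; linarith
    _ = (|t| + 1) * q := by ring
    _ ≤ (|t| + 1) * Q := mul_le_mul_of_nonneg_left hqQ (by positivity)

/-- Solutions at two scales `Q` and `Q'` are not proportional, provided that the error `η'` allowed
at the scale `Q'` is small compared with `Q ^ (-5/4)`. -/
theorem cross_ne_zero_of_scales {a t c Q η' : ℝ} (hc : 0 < c)
    (hdio : ∀ m n : ℤ, n ≠ 0 → c * |(n : ℝ)| ^ (-(5 / 4) : ℝ) ≤ |n * a - m|)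
    (hη' : (1 + |a|) * η' < c * ((|t| + 1) * Q) ^ (-(5 / 4) : ℝ))
    {q p r q' p' r' : ℤ} (hq : 0 < q) (hqQ : (q : ℝ) ≤ Q) (hp0 : p ≠ 0) (hp : |q * t - p| ≤ 1)
    (hq' : 0 < q') (hp0' : p' ≠ 0) (hp1 : |q' * t - p'| ≤ 1) (hp' : |q' * t - p'| ≤ η')
    (hr' : |q' * (a * t) - r'| ≤ η') :
    r * q' - q * r' ≠ 0 ∨ q * p' - p * q' ≠ 0 := by
  by_contra! hcon
  obtain ⟨h1, h2⟩ := hcon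
  have hq0 : (0 : ℝ) < q := by exact_mod_cast hq
  have hq0' : (0 : ℝ) < q' := by exact_mod_cast hq'
  have h1' : (r : ℝ) * q' - q * r' = 0 := by exact_mod_cast h1
  have h2' : (q : ℝ) * p' - p * q' = 0 := by exact_mod_cast h2
  have hL' : |p' * a - r'| ≤ (1 + |a|) * η' := by
    calc |p' * a - r'| = |(q' * (a * t) - r') - a * (q' * t - p')| := by ring_nf
      _ ≤ |q' * (a * t) - r'| + |a * (q' * t - p')| := abs_sub _ _
      _ ≤ η' + |a| * η' := by
        rw [abs_mul]
        exact add_le_add hr' (mul_le_mul_of_nonneg_left hp' (abs_nonneg a))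
      _ = (1 + |a|) * η' := by ring
  rcases le_total q q' with hle | hle
  · have hle' : (q : ℝ) ≤ q' := by exact_mod_cast hle
    have hlow := lower_bound_of_approx (r := r) hc hdio hq hqQ hp0 hp
    have hprop : q' * |p * a - r| = q * |p' * a - r'| := by
      have : (q' : ℝ) * (p * a - r) = q * (p' * a - r') := by
        linear_combination (-a) * h2' - h1'
      simpa only [abs_mul, abs_of_pos hq0, abs_of_pos hq0'] using congrArg abs this
    have : q' * |p * a - r| ≤ q' * |p' * a - r'| := by
      rw [hprop]
      exact mul_le_mul_of_nonneg_right hle' (abs_nonneg _)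
    have := le_of_mul_le_mul_left this hq0'
    linarith
  · have hle' : (q' : ℝ) ≤ q := by exact_mod_cast hle
    have hlow := lower_bound_of_approx (r := r') hc hdio hq' (hle'.trans hqQ) hp0' hp1
    linarith

/-- An integral determinant whose rows approximate multiples of a common vector `(1, x, y)`
vanishes as soon as the approximations are good enough. -/
theorem det_eq_zero_of_scales {x y Q₃ η₁ η₂ η₃ : ℝ} (h₁₂ : η₂ ≤ η₁) (h₂₃ : η₃ ≤ η₂)
    (hsmall : 6 * (Q₃ * (η₁ * η₂)) < 1)
    {q₁ p₁ r₁ q₂ p₂ r₂ q₃ p₃ r₃ : ℤ} (hq₁ : 0 < q₁) (hq₂ : 0 < q₂) (hq₃ : 0 < q₃)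
    (hQ₁ : (q₁ : ℝ) ≤ Q₃) (hQ₂ : (q₂ : ℝ) ≤ Q₃) (hQ₃ : (q₃ : ℝ) ≤ Q₃)
    (hp₁ : |q₁ * x - p₁| ≤ η₁) (hr₁ : |q₁ * y - r₁| ≤ η₁)
    (hp₂ : |q₂ * x - p₂| ≤ η₂) (hr₂ : |q₂ * y - r₂| ≤ η₂)
    (hp₃ : |q₃ * x - p₃| ≤ η₃) (hr₃ : |q₃ * y - r₃| ≤ η₃) :
    q₃ * (p₁ * r₂ - r₁ * p₂) + p₃ * (r₁ * q₂ - q₁ * r₂) + r₃ * (q₁ * p₂ - p₁ * q₂) = 0 := by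
  have hη₃ : 0 ≤ η₃ := (abs_nonneg _).trans hp₃
  have hη₂ : 0 ≤ η₂ := hη₃.trans h₂₃
  have hη₁ : 0 ≤ η₁ := hη₂.trans h₁₂
  have minor : ∀ {q : ℤ} {e f e' f' η η' : ℝ}, 0 < q → (q : ℝ) ≤ Q₃ → |e| ≤ η → |f| ≤ η →
      |e'| ≤ η' → |f'| ≤ η' → η * η' ≤ η₁ * η₂ →
      |q * (e * f' - f * e')| ≤ 2 * (Q₃ * (η₁ * η₂)) := by
    intro q e f e' f' η η' hq hqQ he hf he' hf' hle
    have hη : 0 ≤ η := (abs_nonneg _).trans he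
    have hq0 : (0 : ℝ) < q := by exact_mod_cast hq
    have h1 : |e * f' - f * e'| ≤ 2 * (η₁ * η₂) := by
      refine (abs_sub _ _).trans ?_
      rw [abs_mul, abs_mul]
      have := mul_le_mul he hf' (abs_nonneg _) hη
      have := mul_le_mul hf he' (abs_nonneg _) hη
      linarith
    rw [abs_mul, abs_of_pos hq0]
    calc (q : ℝ) * |e * f' - f * e'| ≤ Q₃ * (2 * (η₁ * η₂)) :=
          mul_le_mul hqQ h1 (abs_nonneg _) (hq0.le.trans hqQ)
      _ = 2 * (Q₃ * (η₁ * η₂)) := by ring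
  have b₃ := minor hq₃ hQ₃ hp₁ hr₁ hp₂ hr₂ le_rfl
  have b₂ := minor hq₂ hQ₂ hp₁ hr₁ hp₃ hr₃ (mul_le_mul_of_nonneg_left h₂₃ hη₁)
  have b₁ := minor hq₁ hQ₁ hp₂ hr₂ hp₃ hr₃
    (mul_le_mul h₁₂ h₂₃ hη₃ hη₁)
  rw [← Int.abs_lt_one_iff]
  have : |((q₃ * (p₁ * r₂ - r₁ * p₂) + p₃ * (r₁ * q₂ - q₁ * r₂) + r₃ * (q₁ * p₂ - p₁ * q₂) : ℤ) :
      ℝ)| < 1 := by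
    -- Subtracting multiples of the first column turns the other two into columns of errors.
    have hexp : ((q₃ * (p₁ * r₂ - r₁ * p₂) + p₃ * (r₁ * q₂ - q₁ * r₂) + r₃ * (q₁ * p₂ - p₁ * q₂) :
        ℤ) : ℝ) =
        q₃ * ((q₁ * x - p₁) * (q₂ * y - r₂) - (q₁ * y - r₁) * (q₂ * x - p₂))
        - q₂ * ((q₁ * x - p₁) * (q₃ * y - r₃) - (q₁ * y - r₁) * (q₃ * x - p₃))
        + q₁ * ((q₂ * x - p₂) * (q₃ * y - r₃) - (q₂ * y - r₂) * (q₃ * x - p₃)) := by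
      push_cast
      ring
    rw [hexp]
    refine ((abs_add_le _ _).trans (add_le_add (abs_sub _ _) le_rfl)).trans_lt ?_
    linarith
  exact_mod_cast this

/-- A linear form that vanishes at two independent vectors of `ℤ³` vanishes at every vector that is
coplanar with them. The vectors have nonzero first coordinate, and the independence of the first
two is expressed by two coordinates of their cross product. -/
theorem linear_form_eq_zero_of_det_eq_zero {u v w q₁ p₁ r₁ q₂ p₂ r₂ q₃ p₃ r₃ : ℤ}
    (hcross : r₁ * q₂ - q₁ * r₂ ≠ 0 ∨ q₁ * p₂ - p₁ * q₂ ≠ 0)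
    (hdet : q₃ * (p₁ * r₂ - r₁ * p₂) + p₃ * (r₁ * q₂ - q₁ * r₂) + r₃ * (q₁ * p₂ - p₁ * q₂) = 0)
    (h₁ : u * q₁ + v * p₁ + w * r₁ = 0) (h₂ : u * q₂ + v * p₂ + w * r₂ = 0) :
    u * q₃ + v * p₃ + w * r₃ = 0 := by
  rcases hcross with h | h
  · refine (mul_eq_zero.1 (?_ : (r₁ * q₂ - q₁ * r₂) * (u * q₃ + v * p₃ + w * r₃) = 0)).resolve_left h
    linear_combination v * hdet + (q₂ * r₃ - r₂ * q₃) * h₁ - (q₁ * r₃ - r₁ * q₃) * h₂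
  · refine (mul_eq_zero.1 (?_ : (q₁ * p₂ - p₁ * q₂) * (u * q₃ + v * p₃ + w * r₃) = 0)).resolve_left h
    linear_combination w * hdet - (q₂ * p₃ - p₂ * q₃) * h₁ + (q₁ * p₃ - p₁ * q₃) * h₂

/-- For Diophantine `a`, an extremal point `(t, a t)` of the plane lies on a rational line. -/
theorem exists_int_relation {a t Q₀ : ℝ} (ha : IsDiophantine a) (ht : t ≠ 0)
    (happ : ∀ Q : ℝ, Q₀ < Q → ∃ q p r : ℤ, 0 < q ∧ (q : ℝ) ≤ Q ∧
      |q * t - p| ≤ Q ^ (-(19 / 20) : ℝ) ∧ |q * (a * t) - r| ≤ Q ^ (-(19 / 20) : ℝ)) :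
    ∃ u v w : ℤ, (v ≠ 0 ∨ w ≠ 0) ∧ (u : ℝ) + v * t + w * (a * t) = 0 := by
  obtain ⟨-, c, hc, hdio⟩ := ha
  have hT : 0 < |t| + 1 := by positivity
  have E1 : ∀ᶠ Q : ℝ in atTop, Q ^ (-(19 / 20) : ℝ) < |t| :=
    (tendsto_rpow_neg_atTop (by norm_num)).eventually_lt_const (abs_pos.2 ht)
  have E2 : ∀ᶠ Q : ℝ in atTop, (1 + |a|) * Q ^ (-(7 / 40) : ℝ) < c * (|t| + 1) ^ (-(5 / 4) : ℝ) := by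
    have := (tendsto_rpow_neg_atTop (y := 7 / 40) (by norm_num)).const_mul (1 + |a|)
    rw [mul_zero] at this
    exact this.eventually_lt_const (by positivity)
  have E3 : ∀ᶠ Q : ℝ in atTop, 6 * Q ^ (-(1 / 8) : ℝ) < 1 := by
    have := (tendsto_rpow_neg_atTop (y := 1 / 8) (by norm_num)).const_mul 6
    rw [mul_zero] at this
    exact this.eventually_lt_const one_pos
  obtain ⟨X, hX⟩ := eventually_atTop.1
    (E1.and (E2.and (E3.and ((eventually_gt_atTop Q₀).and (eventually_gt_atTop (1 : ℝ))))))
  have hX1 : 1 < X := (hX X le_rfl).2.2.2.2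
  set S : ℕ → ℝ := fun n => X ^ ((3 / 2 : ℝ) ^ n) with hS
  have hSX : ∀ n, X ≤ S n := fun n =>
    Real.self_le_rpow_of_one_le hX1.le (one_le_pow₀ (by norm_num))
  have hS1 : ∀ n, 1 < S n := fun n => hX1.trans_le (hSX n)
  have hS0 : ∀ n, 0 < S n := fun n => one_pos.trans (hS1 n)
  have hSsucc : ∀ n, S (n + 1) = S n ^ (3 / 2 : ℝ) := fun n => by
    rw [hS]
    dsimp only
    rw [← Real.rpow_mul (by linarith), pow_succ]
  have hSmono : ∀ n, S n ≤ S (n + 1) := fun n => by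
    rw [hSsucc]
    exact Real.self_le_rpow_of_one_le (hS1 n).le (by norm_num)
  have hSlim : Tendsto S atTop atTop :=
    (tendsto_rpow_atTop_of_base_gt_one X hX1).comp
      (tendsto_pow_atTop_atTop_of_one_lt (by norm_num))
  choose q p r hq hqS hp hr using fun n => happ (S n) (hX (S n) (hSX n)).2.2.2.1
  have hη1 : ∀ n, S n ^ (-(19 / 20) : ℝ) ≤ 1 := fun n =>
    Real.rpow_le_one_of_one_le_of_nonpos (hS1 n).le (by norm_num)
  have hηmono : ∀ n, S (n + 1) ^ (-(19 / 20) : ℝ) ≤ S n ^ (-(19 / 20) : ℝ) := fun n =>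
    Real.rpow_le_rpow_of_nonpos (hS0 n) (hSmono n) (by norm_num)
  have hp0 : ∀ n, p n ≠ 0 := fun n h0 => by
    have h1 := (hp n).trans_lt (hX (S n) (hSX n)).1
    have hq1 : (1 : ℝ) ≤ q n := by exact_mod_cast hq n
    rw [h0, Int.cast_zero, sub_zero, abs_mul, abs_of_pos (by linarith : (0 : ℝ) < q n)] at h1
    nlinarith [abs_nonneg t]
  have hcross : ∀ n, r n * q (n + 1) - q n * r (n + 1) ≠ 0 ∨
      q n * p (n + 1) - p n * q (n + 1) ≠ 0 := fun n => by
    refine cross_ne_zero_of_scales hc hdio ?_ (hq n) (hqS n) (hp0 n) ((hp n).trans (hη1 n))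
      (hq _) (hp0 _) ((hp _).trans (hη1 _)) (hp _) (hr _)
    have h1 : S (n + 1) ^ (-(19 / 20) : ℝ) = S n ^ (-(7 / 40) : ℝ) * S n ^ (-(5 / 4) : ℝ) := by
      rw [hSsucc, ← Real.rpow_mul (hS0 n).le, ← Real.rpow_add (hS0 n)]
      norm_num
    rw [h1, Real.mul_rpow hT.le (hS0 n).le, ← mul_assoc, ← mul_assoc]
    exact mul_lt_mul_of_pos_right (hX (S n) (hSX n)).2.1 (Real.rpow_pos_of_pos (hS0 n) _)
  have hdet : ∀ n, q (n + 2) * (p n * r (n + 1) - r n * p (n + 1))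
      + p (n + 2) * (r n * q (n + 1) - q n * r (n + 1))
      + r (n + 2) * (q n * p (n + 1) - p n * q (n + 1)) = 0 := fun n => by
    refine det_eq_zero_of_scales (hηmono n) (hηmono (n + 1)) ?_ (hq _) (hq _) (hq _)
      ((hqS n).trans ((hSmono n).trans (hSmono (n + 1)))) ((hqS _).trans (hSmono (n + 1)))
      (hqS (n + 2)) (hp _) (hr _) (hp _) (hr _) (hp _) (hr _)
    have h1 : S (n + 1 + 1) * (S n ^ (-(19 / 20) : ℝ) * S (n + 1) ^ (-(19 / 20) : ℝ))
        = S n ^ (-(1 / 8) : ℝ) := by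
      rw [hSsucc (n + 1), hSsucc n, ← Real.rpow_mul (hS0 n).le, ← Real.rpow_mul (hS0 n).le,
        ← Real.rpow_add (hS0 n), ← Real.rpow_add (hS0 n)]
      norm_num
    rw [h1]
    exact (hX (S n) (hSX n)).2.2.1
  set u := p 0 * r 1 - r 0 * p 1
  set v := r 0 * q 1 - q 0 * r 1
  set w := q 0 * p 1 - p 0 * q 1
  have hplane : ∀ n, u * q n + v * p n + w * r n = 0 ∧
      u * q (n + 1) + v * p (n + 1) + w * r (n + 1) = 0 := by
    intro n
    induction n with
    | zero => exact ⟨by ring, by ring⟩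
    | succ n ih => exact ⟨ih.2, linear_form_eq_zero_of_det_eq_zero (hcross n) (hdet n) ih.1 ih.2⟩
  refine ⟨u, v, w, hcross 0, ?_⟩
  have hbound : ∀ n, |(u : ℝ) + v * t + w * (a * t)| ≤
      (|(v : ℝ)| + |(w : ℝ)|) * S n ^ (-(19 / 20) : ℝ) := fun n => by
    have hq1 : (1 : ℝ) ≤ q n := by exact_mod_cast hq n
    have h0 : (u : ℝ) * q n + v * p n + w * r n = 0 := by exact_mod_cast (hplane n).1
    calc |(u : ℝ) + v * t + w * (a * t)|
        ≤ q n * |(u : ℝ) + v * t + w * (a * t)| := le_mul_of_one_le_left (abs_nonneg _) hq1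
      _ = |q n * ((u : ℝ) + v * t + w * (a * t))| := by
        rw [abs_mul, abs_of_pos (by linarith : (0 : ℝ) < q n)]
      _ = |v * (q n * t - p n) + w * (q n * (a * t) - r n)| := by
        congr 1
        linear_combination h0
      _ ≤ |(v : ℝ)| * |q n * t - p n| + |(w : ℝ)| * |q n * (a * t) - r n| := by
        rw [← abs_mul, ← abs_mul]
        exact abs_add_le _ _
      _ ≤ _ := by
        rw [add_mul]
        exact add_le_add (mul_le_mul_of_nonneg_left (hp n) (abs_nonneg _))
          (mul_le_mul_of_nonneg_left (hr n) (abs_nonneg _))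
  have hlim : Tendsto (fun n => (|(v : ℝ)| + |(w : ℝ)|) * S n ^ (-(19 / 20) : ℝ)) atTop (𝓝 0) := by
    have := ((tendsto_rpow_neg_atTop (y := 19 / 20) (by norm_num)).comp hSlim).const_mul
      (|(v : ℝ)| + |(w : ℝ)|)
    rwa [mul_zero] at this
  exact abs_nonpos_iff.1 (ge_of_tendsto' hlim hbound)

/-! ### The manifolds -/

/-- The functions of the zeroth coordinate whose graphs define `diophantineGraph`: the linear
function `a t` in coordinate `k`, the power `t ^ i` in the coordinates `i > k`, and `0` in the
coordinates `i < k`, which stay free. -/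
def graphFun (k : ℕ) (a : ℝ) (i : ℕ) (t : ℝ) : ℝ :=
  if i < k then 0 else if i = k then a * t else t ^ i

theorem graphFun_of_lt {k i : ℕ} (h : i < k) (a t : ℝ) : graphFun k a i t = 0 := if_pos h

theorem graphFun_self (k : ℕ) (a t : ℝ) : graphFun k a k t = a * t := by simp [graphFun]

theorem graphFun_of_gt {k i : ℕ} (h : k < i) (a t : ℝ) : graphFun k a i t = t ^ i := by
  simp [graphFun, h.not_gt, h.ne']

theorem analyticAt_graphFun (k : ℕ) (a : ℝ) (i : ℕ) (t : ℝ) :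
    AnalyticAt ℝ (graphFun k a i) t := by
  unfold graphFun
  split_ifs <;> fun_prop

/-- The set of the points `x` of `ℝ^(n+1)` with `x_k = a x_0` and `x_i = x_0 ^ i` for `i > k`. -/
def diophantineGraph (n k : ℕ) (a : ℝ) : Set (Fin (n + 1) → ℝ) :=
  {x | ∀ i : Fin (n + 1), k ≤ (i : ℕ) → x i = graphFun k a i (x 0)}

/-- The shear of `ℝ^(n+1)` that straightens `diophantineGraph n k a`. -/
def shear (n k : ℕ) (hk : 1 ≤ k) (a : ℝ) : (Fin (n + 1) → ℝ) ≃ₜ (Fin (n + 1) → ℝ) where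
  toFun y i := y i - graphFun k a i (y 0)
  invFun y i := y i + graphFun k a i (y 0)
  left_inv y := by
    ext i
    simp [graphFun_of_lt (Nat.lt_of_succ_le hk)]
  right_inv y := by
    ext i
    simp [graphFun_of_lt (Nat.lt_of_succ_le hk)]
  continuous_toFun := continuous_pi fun i => (continuous_apply i).sub
    ((continuous_iff_continuousAt.2 fun t => (analyticAt_graphFun k a i t).continuousAt).comp
      (continuous_apply 0))
  continuous_invFun := continuous_pi fun i => (continuous_apply i).add
    ((continuous_iff_continuousAt.2 fun t => (analyticAt_graphFun k a i t).continuousAt).comp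
      (continuous_apply 0))

theorem analyticAt_graphFun_comp {n : ℕ} (k : ℕ) (a : ℝ) (i : ℕ) (y : Fin (n + 1) → ℝ) :
    AnalyticAt ℝ (fun y : Fin (n + 1) → ℝ => graphFun k a i (y 0)) y :=
  AnalyticAt.fun_comp (f := fun y : Fin (n + 1) → ℝ => y 0) (analyticAt_graphFun k a i (y 0))
    ((ContinuousLinearMap.proj (R := ℝ) (φ := fun _ : Fin (n + 1) => ℝ) 0).analyticAt y)

theorem isAnalyticSubmanifold_diophantineGraph {n k : ℕ} (hk : 1 ≤ k) (hkn : k < n + 1) (a : ℝ) :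
    IsAnalyticSubmanifold k (diophantineGraph n k a) := by
  have hproj : ∀ (i : Fin (n + 1)) (y : Fin (n + 1) → ℝ), AnalyticAt ℝ (fun y => y i) y :=
    fun i y => (ContinuousLinearMap.proj (R := ℝ) (φ := fun _ : Fin (n + 1) => ℝ) i).analyticAt y
  refine ⟨hkn.le, fun x _ => ⟨(shear n k hk a).toOpenPartialHomeomorph, trivial, ?_, ?_, ?_⟩⟩
  · exact fun y _ => AnalyticAt.pi fun i => (hproj i y).sub (analyticAt_graphFun_comp k a i y)
  · exact fun y _ => AnalyticAt.pi fun i => (hproj i y).add (analyticAt_graphFun_comp k a i y)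
  · exact fun y _ => forall_congr' fun i => imp_congr_right fun _ => sub_eq_zero.symm

/-- The graph is a continuous image of the space: apply the inverse shear to points whose last
coordinates are replaced by `0`. -/
theorem isConnected_diophantineGraph {n k : ℕ} (hk : 1 ≤ k) (a : ℝ) :
    IsConnected (diophantineGraph n k a) := by
  have hrange : diophantineGraph n k a = Set.range fun y : Fin (n + 1) → ℝ =>
      (shear n k hk a).symm fun i => if (i : ℕ) < k then y i else 0 := by
    ext x
    have h0 : ((0 : Fin (n + 1)) : ℕ) < k := hk
    constructor
    · intro hx
      refine ⟨x, funext fun i => ?_⟩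
      change (if (i : ℕ) < k then x i else 0) +
        graphFun k a i (if ((0 : Fin (n + 1)) : ℕ) < k then x 0 else 0) = x i
      rw [if_pos h0]
      split_ifs with hi
      · rw [graphFun_of_lt hi, add_zero]
      · rw [zero_add, hx i (not_lt.1 hi)]
    · rintro ⟨y, rfl⟩ i hi
      change (if (i : ℕ) < k then y i else 0) +
          graphFun k a i (if ((0 : Fin (n + 1)) : ℕ) < k then y 0 else 0) =
        graphFun k a i ((if ((0 : Fin (n + 1)) : ℕ) < k then y 0 else 0) +
          graphFun k a (0 : Fin (n + 1)) (if ((0 : Fin (n + 1)) : ℕ) < k then y 0 else 0))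
      rw [if_pos h0, if_neg hi.not_gt, graphFun_of_lt h0, zero_add, add_zero]
  rw [hrange]
  refine isConnected_range ((shear n k hk a).symm.continuous.comp (continuous_pi fun i => ?_))
  split_ifs
  · exact continuous_apply i
  · exact continuous_const

/-- A point of the graph with prescribed coordinates below `k`. -/
theorem mem_diophantineGraph_ite {n k : ℕ} (hk : 1 ≤ k) (a : ℝ) (y : Fin (n + 1) → ℝ) :
    (fun i : Fin (n + 1) => if (i : ℕ) < k then y i else graphFun k a i (y 0)) ∈
      diophantineGraph n k a := by
  intro i hi
  have h0 : ((0 : Fin (n + 1)) : ℕ) < k := hk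
  simp only [if_neg hi.not_gt, if_pos h0]

open Polynomial in
/-- The graph contains the curve `(t, t ^ 2, …, t ^ k, a t, t ^ (k + 1), …, t ^ n)`, in which `a t`
is the only coordinate whose exponent repeats another one. -/
theorem not_diophantineGraph_subset {n k : ℕ} (hk : 1 ≤ k) (hkn : k < n + 1) {a : ℝ}
    (ha : Irrational a) {H : Set (Fin (n + 1) → ℝ)} (hH : IsRationalHyperplane H) :
    ¬ diophantineGraph n k a ⊆ H := by
  obtain ⟨c, b, hc, rfl⟩ := hH
  intro hsub
  have h0 : ((0 : Fin (n + 1)) : ℕ) < k := hk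
  set e : Fin (n + 1) → ℕ := fun i => if (i : ℕ) < k then i + 1 else if (i : ℕ) = k then 1 else i
    with he
  set s : Fin (n + 1) → ℝ := fun i => if (i : ℕ) = k then a else 1 with hs
  set P : ℝ[X] := ∑ i, monomial (e i) ((c i : ℝ) * s i) with hP
  have hPb : P = C (b : ℝ) := by
    refine Polynomial.funext fun t => ?_
    have hmem := hsub (mem_diophantineGraph_ite hk a fun i => t ^ ((i : ℕ) + 1))
    rw [Set.mem_ofPred_eq] at hmem
    rw [eval_C, ← hmem, hP, eval_finsetSum]
    refine Finset.sum_congr rfl fun i _ => ?_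
    rw [eval_monomial, mul_assoc]
    congr 1
    rcases lt_trichotomy (i : ℕ) k with hi | hi | hi
    · simp [he, hs, hi, hi.ne]
    · simp [he, hs, hi, graphFun_self]
    · simp [he, hs, hi.not_gt, hi.ne', graphFun_of_gt hi]
  have hcoeff : ∀ j, 0 < j → ∑ i, (if e i = j then (c i : ℝ) * s i else 0) = 0 := fun j hj => by
    have h1 := congrArg (fun R : ℝ[X] => R.coeff j) hPb
    simpa only [hP, finsetSum_coeff, coeff_monomial, coeff_C_of_ne_zero hj.ne'] using h1
  have hc' : ∀ i : Fin (n + 1), i ≠ 0 → (i : ℕ) ≠ k → c i = 0 := fun i hi0 hik => by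
    have hi0' : (i : ℕ) ≠ 0 := fun h => hi0 (Fin.ext h)
    have hpos : 0 < e i := by
      simp only [he]
      split_ifs <;> omega
    have h1 := hcoeff (e i) hpos
    rw [Fintype.sum_eq_single i fun j hj => if_neg fun hji => hj (Fin.ext ?_), if_pos rfl] at h1
    · simpa [hs, hik] using h1
    · simp only [he] at hji
      split_ifs at hji <;> omega
  have hk0 : (0 : Fin (n + 1)) ≠ ⟨k, hkn⟩ := fun h => h0.ne (congrArg Fin.val h)
  have hlin : (c 0 : ℝ) + c ⟨k, hkn⟩ * a = 0 := by
    have h1 := hcoeff 1 one_pos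
    rw [Fintype.sum_eq_add 0 ⟨k, hkn⟩ hk0 fun j hj => by
      rw [hc' j hj.1 fun h => hj.2 (Fin.ext h)]; simp] at h1
    have he0 : e 0 = 1 := if_pos h0
    have hs0 : s 0 = 1 := if_neg h0.ne
    have hek : e ⟨k, hkn⟩ = 1 := by simp [he]
    have hsk : s ⟨k, hkn⟩ = a := if_pos rfl
    rwa [he0, hs0, hek, hsk, if_pos rfl, if_pos rfl, mul_one] at h1
  have hck : c ⟨k, hkn⟩ = 0 := by
    by_contra hne
    refine ha.ne_rat (-c 0 / c ⟨k, hkn⟩) ?_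
    have : (c ⟨k, hkn⟩ : ℝ) ≠ 0 := by exact_mod_cast hne
    push_cast
    rw [eq_div_iff this]
    linarith
  refine hc (funext fun i => ?_)
  by_cases hi0 : i = 0
  · subst hi0
    rw [hck] at hlin
    simpa using hlin
  · by_cases hik : (i : ℕ) = k
    · obtain rfl : i = ⟨k, hkn⟩ := Fin.ext hik
      exact hck
    · exact hc' i hi0 hik

theorem diophantineGraph_injective {n k : ℕ} (hk : 1 ≤ k) (hkn : k < n + 1) :
    Function.Injective (diophantineGraph n k) := by
  intro a a' h
  have h1 := mem_diophantineGraph_ite (n := n) hk a 1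
  rw [h] at h1
  have h2 := h1 ⟨k, hkn⟩ le_rfl
  have h0 : ((0 : Fin (n + 1)) : ℕ) < k := hk
  simpa only [graphFun_self, if_pos h0, lt_irrefl, if_false, Pi.one_apply, mul_one] using h2

theorem exists_rationalHyperplane_of_isDeltaExtremal {n k : ℕ} (hk : 1 ≤ k) (hkn : k < n + 1)
    {a : ℝ} (ha : IsDiophantine a) {x : Fin (n + 1) → ℝ} (hx : x ∈ diophantineGraph n k a)
    (hext : IsDeltaExtremal (19 / 20) x) :
    ∃ H : Set (Fin (n + 1) → ℝ), IsRationalHyperplane H ∧ x ∈ H := by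
  have hk0 : (⟨k, hkn⟩ : Fin (n + 1)) ≠ 0 := fun h => by
    have := congrArg Fin.val h
    simp only [Fin.val_zero] at this
    omega
  have hxk : x ⟨k, hkn⟩ = a * x 0 := by rw [hx ⟨k, hkn⟩ le_rfl, graphFun_self]
  have key : ∃ u v w : ℤ, (v ≠ 0 ∨ w ≠ 0) ∧ (u : ℝ) + v * x 0 + w * (a * x 0) = 0 := by
    by_cases ht : x 0 = 0
    · exact ⟨0, 1, 0, Or.inl one_ne_zero, by simp [ht]⟩
    · obtain ⟨Q₀, -, hQ⟩ := hext
      refine exists_int_relation (Q₀ := Q₀) ha ht fun Q hQQ => ?_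
      obtain ⟨q, p, hq, hqQ, hnorm⟩ := hQ Q hQQ
      have hcoord : ∀ i, |(q : ℝ) * x i - p i| ≤ Q ^ (-(19 / 20) : ℝ) := fun i =>
        (norm_le_pi_norm (fun i => (q : ℝ) * x i - (p i : ℝ)) i).trans hnorm
      exact ⟨q, p 0, p ⟨k, hkn⟩, by exact_mod_cast hq, by exact_mod_cast hqQ,
        by exact_mod_cast hcoord 0, by rw [← hxk]; exact_mod_cast hcoord ⟨k, hkn⟩⟩
  obtain ⟨u, v, w, hvw, hrel⟩ := key
  refine ⟨_, ⟨Pi.single 0 (v : ℚ) + Pi.single ⟨k, hkn⟩ (w : ℚ), -u, fun h => ?_, rfl⟩, ?_⟩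
  · have h0 := congrFun h 0
    have h1 := congrFun h ⟨k, hkn⟩
    simp [hk0, hk0.symm] at h0 h1
    tauto
  · have hsingle : ∀ (j : Fin (n + 1)) (m : ℤ),
        ∑ i, (((Pi.single j (m : ℚ) : Fin (n + 1) → ℚ) i : ℚ) : ℝ) * x i = m * x j := fun j m => by
      rw [Fintype.sum_eq_single j fun i hi => by rw [Pi.single_eq_of_ne hi]; simp]
      simp
    simp only [Set.mem_ofPred_eq, Pi.add_apply, Rat.cast_add, add_mul, Finset.sum_add_distrib,
      hsingle, hxk]
    push_cast
    linarith

theorem mainTheorem8 :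
    ∃ δ : ℝ, 0 < δ ∧ δ < 1 ∧
      ∀ k d : ℕ, 1 ≤ k → k < d →
        ¬ Set.Countable {M : Set (Fin d → ℝ) |
          IsConnected M ∧ IsAnalyticSubmanifold k M ∧
          (∀ H : Set (Fin d → ℝ), IsRationalHyperplane H → ¬ M ⊆ H) ∧
          (∀ x ∈ M, IsDeltaExtremal δ x →
            ∃ H : Set (Fin d → ℝ), IsRationalHyperplane H ∧ x ∈ H)} := by
  refine ⟨19 / 20, by norm_num, by norm_num, fun k d hk hkd hcount => ?_⟩
  obtain ⟨n, rfl⟩ : ∃ n, d = n + 1 := ⟨d - 1, by omega⟩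
  refine not_countable_isDiophantine ((hcount.preimage_of_injOn
    (diophantineGraph_injective hk hkd).injOn).mono fun a ha => ?_)
  exact ⟨isConnected_diophantineGraph hk a, isAnalyticSubmanifold_diophantineGraph hk hkd a,
    fun H hH => not_diophantineGraph_subset hk hkd ha.1 hH,
    fun x hx hext => exists_rationalHyperplane_of_isDeltaExtremal hk hkd ha hx hext⟩
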